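/- Let $N,K\in\mathbb{N}$ and $\gamma\in[0,1]$. Equip $\mathbb{R}^{N\times K}$ with the inner product $\langle Z,Z'\rangle=\operatorname{tr}(Z^TZ')$, write $z_n\in\mathbb{R}^K$ ($n=1,\dots,N$) for the rows of $Z$, and for a symmetric positive semidefinite $W\in\mathbb{R}^{K\times K}$ put $\|z\|_W=\sqrt{z^TWz}$ and $\|Z\|_{W,1}=\sum_{n=1}^N\|z_n\|_W$; also $\|Z\|_{2,1}=\sum_{n=1}^N\|z_n\|_2$. Let $M[Z]=\gamma I+(1-\gamma)Z^TZ$ and $$\Psi_\gamma(Z)=\big\|Z\,M[Z]^{\dagger/2}\big\|_{2,1},$$ where $M^{\dagger/2}$ is the positive semidefinite square root of the Moore--Penrose pseudo-inverse of $M$. Let $\widehat Z\in\mathbb{R}^{N\times K}$ be such that $\widehat M=M[\widehat Z]$ is invertible, put $\widehat W=\widehat M^{-1}$ and $$\widehat\Lambda=-\sum_{n=1}^N\frac{1-\gamma}{\|\widehat z_n\|_{\widehat W}}\,\widehat W\widehat z_n\widehat z_n^T\widehat W$$ (terms with $\widehat z_n=0$ are taken to be $0$), and define the convex model function $$m^{\Psi}_{\widehat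 Z}(Z)=\|Z\|_{\widehat W,1}+\langle\widehat Z\widehat\Lambda,\,Z-\widehat Z\rangle .$$ Then $\Psi_\gamma$ is Lipschitz continuous on a neighbourhood of $\widehat Z$, and $$\partial_C\Psi_\gamma(\widehat Z)=\partial m^{\Psi}_{\widehat Z}(\widehat Z).$$ Here $\partial_C f(\widehat Z)$ is the Clarke subdifferential, i.e. the set of all $G\in\mathbb{R}^{N\times K}$ with $\langle G,V\rangle\le\limsup_{Y\to\widehat Z,\ t\downarrow0}\frac{f(Y+tV)-f(Y)}{t}$ for all $V\in\mathbb{R}^{N\times K}$, and $\partial m(\widehat Z)$ is the subdifferential of convex analysis, i.e. the set of all $G$ with $m(Z)\ge m(\widehat Z)+\langle G,Z-\widehat Z\rangle$ for all $Z$. -/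

import Mathlib

open Matrix Filter Topology
open scoped MatrixOrder

noncomputable section

/-- The four Penrose equations: `X` is a Moore-Penrose pseudo-inverse of the real matrix `A`. -/
structure IsMoorePenrose {m n : ℕ} (A : Matrix (Fin m) (Fin n) ℝ)
    (X : Matrix (Fin n) (Fin m) ℝ) : Prop where
  mul_mul_self : A * X * A = A
  self_mul_mul : X * A * X = X
  symm_left : (A * X)ᵀ = A * X
  symm_right : (X * A)ᵀ = X * A

/-- A real symmetric matrix has a pseudo-inverse. -/
theorem exists_isMoorePenrose_of_isHermitian {n : ℕ} (S : Matrix (Fin n) (Fin n) ℝ)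
    (hS : S.IsHermitian) : ∃ X, IsMoorePenrose S X := by
  obtain ⟨U, d, hU, hU', hSd⟩ : ∃ (U : Matrix (Fin n) (Fin n) ℝ) (d : Fin n → ℝ),
      U * Uᵀ = 1 ∧ Uᵀ * U = 1 ∧ S = U * diagonal d * Uᵀ := by
    refine ⟨hS.eigenvectorUnitary, hS.eigenvalues, ?_, ?_, ?_⟩
    · simpa [star_eq_conjTranspose] using Unitary.coe_mul_star_self hS.eigenvectorUnitary
    · simpa [star_eq_conjTranspose] using Unitary.coe_star_mul_self hS.eigenvectorUnitary
    · have := hS.spectral_theorem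
      simpa [Unitary.conjStarAlgAut_apply, star_eq_conjTranspose] using this
  have key : ∀ a b : Fin n → ℝ, (U * diagonal a * Uᵀ) * (U * diagonal b * Uᵀ)
      = U * diagonal (fun i => a i * b i) * Uᵀ := by
    intro a b
    calc _ = U * diagonal a * (Uᵀ * U) * diagonal b * Uᵀ := by simp only [Matrix.mul_assoc]
      _ = _ := by rw [hU', Matrix.mul_one, Matrix.mul_assoc U, diagonal_mul_diagonal]
  have hT : ∀ a : Fin n → ℝ, (U * diagonal a * Uᵀ)ᵀ = U * diagonal a * Uᵀ := by
    intro a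
    simp [Matrix.transpose_mul, Matrix.mul_assoc]
  refine ⟨U * diagonal (fun i => (d i)⁻¹) * Uᵀ, ?_, ?_, ?_, ?_⟩
  · rw [hSd, key, key]
    congr 3
    ext i
    by_cases h : d i = 0 <;> simp [h]
  · rw [hSd, key, key]
    congr 3
    ext i
    by_cases h : d i = 0 <;> simp [h]
  · rw [hSd, key, hT]
  · rw [hSd, key, hT]

theorem exists_isMoorePenrose {m n : ℕ} (A : Matrix (Fin m) (Fin n) ℝ) :
    ∃ X, IsMoorePenrose A X := by
  obtain ⟨P, h1, h2, h3, h4⟩ := exists_isMoorePenrose_of_isHermitian (Aᵀ * A)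
    (by simpa using isHermitian_conjTranspose_mul_self A)
  have hA : A * (P * (Aᵀ * A)) = A := by
    have h : Aᴴ * A * (P * (Aᵀ * A) - 1) = 0 := by
      rw [conjTranspose_eq_transpose_of_trivial, Matrix.mul_sub, ← Matrix.mul_assoc, h1]
      simp
    rw [conjTranspose_mul_self_mul_eq_zero, Matrix.mul_sub, sub_eq_zero] at h
    simpa using h
  have hA' : Aᵀ * A * Pᵀ * Aᵀ = Aᵀ := by
    have := congrArg transpose hA
    simpa [Matrix.transpose_mul, Matrix.mul_assoc] using this
  have hc : Aᵀ * A * Pᵀ = P * (Aᵀ * A) := by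
    have := h4
    simpa [Matrix.transpose_mul, Matrix.mul_assoc] using this
  refine ⟨P * Aᵀ, ?_, ?_, ?_, ?_⟩
  · simpa [Matrix.mul_assoc] using hA
  · have := congrArg (· * Aᵀ) h2
    simpa [Matrix.mul_assoc] using this
  · -- `A P Aᵀ = (A P Aᵀ A) Pᵀ Aᵀ = A Pᵀ Aᵀ`
    have e : A * Pᵀ * Aᵀ = A * P * Aᵀ := by
      calc A * Pᵀ * Aᵀ = (A * (P * (Aᵀ * A))) * Pᵀ * Aᵀ := by rw [hA]
        _ = A * P * (Aᵀ * A * Pᵀ * Aᵀ) := by simp only [Matrix.mul_assoc]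
        _ = A * P * Aᵀ := by rw [hA']
    simpa [Matrix.transpose_mul, Matrix.mul_assoc] using e
  · simpa [Matrix.mul_assoc] using h4

theorem IsMoorePenrose.unique {m n : ℕ} {A : Matrix (Fin m) (Fin n) ℝ}
    {X Y : Matrix (Fin n) (Fin m) ℝ} (hX : IsMoorePenrose A X) (hY : IsMoorePenrose A Y) :
    X = Y := by
  have h1 : A * X = A * Y := by
    calc A * X = (A * X)ᵀ := hX.symm_left.symm
      _ = ((A * Y) * (A * X))ᵀ := by rw [← Matrix.mul_assoc, hY.mul_mul_self]
      _ = (A * X)ᵀ * (A * Y)ᵀ := transpose_mul _ _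
      _ = (A * X) * (A * Y) := by rw [hX.symm_left, hY.symm_left]
      _ = A * Y := by rw [← Matrix.mul_assoc, hX.mul_mul_self]
  have h2 : X * A = Y * A := by
    calc X * A = (X * A)ᵀ := hX.symm_right.symm
      _ = ((X * A) * (Y * A))ᵀ := by
          rw [Matrix.mul_assoc X A, ← Matrix.mul_assoc A Y A, hY.mul_mul_self]
      _ = (Y * A)ᵀ * (X * A)ᵀ := transpose_mul _ _
      _ = (Y * A) * (X * A) := by rw [hX.symm_right, hY.symm_right]
      _ = Y * A := by rw [Matrix.mul_assoc Y A, ← Matrix.mul_assoc A X A, hX.mul_mul_self]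
  calc X = X * A * X := hX.self_mul_mul.symm
    _ = Y * (A * X) := by rw [h2, Matrix.mul_assoc]
    _ = Y := by rw [h1, ← Matrix.mul_assoc, hY.self_mul_mul]

/-- The Moore-Penrose pseudo-inverse of a real matrix. -/
def pinv {m n : ℕ} (A : Matrix (Fin m) (Fin n) ℝ) : Matrix (Fin n) (Fin m) ℝ :=
  Classical.choose (exists_isMoorePenrose A)

theorem pinv_spec {m n : ℕ} (A : Matrix (Fin m) (Fin n) ℝ) : IsMoorePenrose A (pinv A) :=
  Classical.choose_spec (exists_isMoorePenrose A)

/-- `M^{†/2}`: the positive semidefinite square root of the pseudo-inverse of a symmetric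
positive semidefinite matrix. -/
def pinvSqrt {K : ℕ} (M : Matrix (Fin K) (Fin K) ℝ) : Matrix (Fin K) (Fin K) ℝ :=
  CFC.sqrt (pinv M)

/-- The trace inner product `⟨A, B⟩ = tr (Aᵀ B)` on matrices. -/
def traceInner {N K : ℕ} (A B : Matrix (Fin N) (Fin K) ℝ) : ℝ := (Aᵀ * B).trace

/-- The Frobenius norm. -/
def frobNorm {N K : ℕ} (A : Matrix (Fin N) (Fin K) ℝ) : ℝ := √(traceInner A A)

/-- `‖z‖_W = √(zᵀ W z)`. -/
def weightedNorm {K : ℕ} (W : Matrix (Fin K) (Fin K) ℝ) (z : Fin K → ℝ) : ℝ :=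
  √(z ⬝ᵥ (W *ᵥ z))

/-- `‖Z‖_{W,1}`: the sum of the `W`-norms of the rows of `Z`. -/
def weightedRowSum {N K : ℕ} (W : Matrix (Fin K) (Fin K) ℝ) (Z : Matrix (Fin N) (Fin K) ℝ) : ℝ :=
  ∑ n, weightedNorm W (Z n)

/-- `‖Z‖_{2,1}`: the sum of the Euclidean norms of the rows of `Z`. -/
def l21Norm {N K : ℕ} (Z : Matrix (Fin N) (Fin K) ℝ) : ℝ := ∑ n, ‖WithLp.toLp 2 (Z n)‖

/-- `M[Z] = γ I + (1 - γ) Zᵀ Z`. -/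
def gramMatrix {N K : ℕ} (γ : ℝ) (Z : Matrix (Fin N) (Fin K) ℝ) : Matrix (Fin K) (Fin K) ℝ :=
  γ • (1 : Matrix (Fin K) (Fin K) ℝ) + (1 - γ) • (Zᵀ * Z)

/-- `Ψ_γ(Z) = ‖Z (γ I + (1 - γ) Zᵀ Z)^{†/2}‖_{2,1}`. -/
def Psi {N K : ℕ} (γ : ℝ) (Z : Matrix (Fin N) (Fin K) ℝ) : ℝ :=
  l21Norm (Z * pinvSqrt (gramMatrix γ Z))

/-- `Λ̂ = - ∑ₙ (1 - γ) / ‖ẑₙ‖_Ŵ • Ŵ ẑₙ ẑₙᵀ Ŵ` with `Ŵ = M[Ẑ]⁻¹`; the terms with `ẑₙ = 0`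
are zero. -/
def lambdaHat {N K : ℕ} (γ : ℝ) (Zh : Matrix (Fin N) (Fin K) ℝ) : Matrix (Fin K) (Fin K) ℝ :=
  -∑ n, ((1 - γ) / weightedNorm (gramMatrix γ Zh)⁻¹ (Zh n)) •
    ((gramMatrix γ Zh)⁻¹ * vecMulVec (Zh n) (Zh n) * (gramMatrix γ Zh)⁻¹)

/-- The model function `m_Ẑ(Z) = ‖Z‖_{Ŵ,1} + ⟨Ẑ Λ̂, Z - Ẑ⟩` with `Ŵ = M[Ẑ]⁻¹`. -/
def modelPsi {N K : ℕ} (γ : ℝ) (Zh Z : Matrix (Fin N) (Fin K) ℝ) : ℝ :=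
  weightedRowSum (gramMatrix γ Zh)⁻¹ Z + traceInner (Zh * lambdaHat γ Zh) (Z - Zh)

/-- `f` is Lipschitz (in the Frobenius norm) on some neighbourhood of `Z`. -/
def IsLipschitzNear {N K : ℕ} (f : Matrix (Fin N) (Fin K) ℝ → ℝ)
    (Z : Matrix (Fin N) (Fin K) ℝ) : Prop :=
  ∃ L : ℝ, ∃ U ∈ 𝓝 Z, ∀ Z₁ ∈ U, ∀ Z₂ ∈ U, |f Z₁ - f Z₂| ≤ L * frobNorm (Z₁ - Z₂)

/-- Clarke's generalized directional derivative
`f°(Z; V) = limsup_{Y → Z, t ↓ 0} (f (Y + t V) - f Y) / t`, as an extended real. -/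
def clarkeDeriv {N K : ℕ} (f : Matrix (Fin N) (Fin K) ℝ → ℝ)
    (Z V : Matrix (Fin N) (Fin K) ℝ) : EReal :=
  limsup (fun p : Matrix (Fin N) (Fin K) ℝ × ℝ =>
    (((f (p.1 + p.2 • V) - f p.1) / p.2 : ℝ) : EReal)) (𝓝 Z ×ˢ 𝓝[>] (0 : ℝ))

/-- The Clarke subdifferential, as a set of matrices through the trace inner product:
all `G` with `⟨G, V⟩ ≤ f°(Z; V)` for every `V`. -/
def clarkeSubdifferential {N K : ℕ} (f : Matrix (Fin N) (Fin K) ℝ → ℝ)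
    (Z : Matrix (Fin N) (Fin K) ℝ) : Set (Matrix (Fin N) (Fin K) ℝ) :=
  {G | ∀ V, ((traceInner G V : ℝ) : EReal) ≤ clarkeDeriv f Z V}

/-- The subdifferential of convex analysis, as a set of matrices through the trace inner
product. -/
def convexSubdifferential {N K : ℕ} (f : Matrix (Fin N) (Fin K) ℝ → ℝ)
    (Z : Matrix (Fin N) (Fin K) ℝ) : Set (Matrix (Fin N) (Fin K) ℝ) :=
  {G | ∀ Y, f Z + traceInner G (Y - Z) ≤ f Y}

end

/-! ### Square roots of quadratic forms with varying coefficients -/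

section QuadraticForms

variable {E V : Type*} [NormedAddCommGroup E] [NormedSpace ℝ E]
  [NormedAddCommGroup V] [NormedSpace ℝ V]

/-! The difference Ψ_γ - m is strictly differentiable at Ẑ with derivative zero, and m is convex.
Such a perturbation affects neither local Lipschitz continuity nor Clarke's derivative, and for a
convex function Clarke's subdifferential is the convex one
(`clarkeSubdifferential_eq_of_hasStrictFDerivAt_sub`).

Near Ẑ the Gram matrix stays invertible, so Ψ_γ(Z) = ∑ ‖zₙ‖_{W(Z)} with W(Z) = M[Z]⁻¹ smooth in Z.
Each row contributes the error ‖zₙ‖_{W(Z)} - ‖zₙ‖_Ŵ of freezing the weight. If ẑₙ ≠ 0, both norms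
are smooth. If ẑₙ = 0, they have a kink, but the kinks cancel: the difference has Lipschitz constant
tending to 0 on shrinking neighbourhoods (`abs_sqrt_bilin_sub_sub_le`). The derivatives of the row
errors add up to ⟨ẐΛ̂, ·⟩, the linear term of m (`traceInner_lambdaHat`). -/

theorem abs_bilin_self_sub_le (B : V →L[ℝ] V →L[ℝ] ℝ) (u v : V) :
    |B u u - B v v| ≤ ‖B‖ * ‖u - v‖ * (‖u‖ + ‖v‖) := by
  have h : B u u - B v v = B (u - v) u + B v (u - v) := by simp
  have h1 := B.le_opNorm₂ (u - v) u
  have h2 := B.le_opNorm₂ v (u - v)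
  rw [Real.norm_eq_abs] at h1 h2
  rw [h]
  refine (abs_add_le _ _).trans ((add_le_add h1 h2).trans (le_of_eq ?_))
  ring

theorem mul_norm_le_sqrt_bilin {r : ℝ} {B : V →L[ℝ] V →L[ℝ] ℝ} {v : V}
    (h : r ^ 2 * ‖v‖ ^ 2 ≤ B v v) : r * ‖v‖ ≤ √(B v v) :=
  Real.le_sqrt_of_sq_le (by rwa [mul_pow])

/-- Estimates of differences of roots come multiplied by a sum of roots, bounded below by r * t with
t a norm or a sum of two; this cancels t, which may vanish. -/
theorem le_div_of_mul_self_bound {r t D X : ℝ} (hr : 0 < r) (ht : 0 ≤ t) (h0 : t = 0 → D = 0)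
    (hX : 0 ≤ X) (h : r * t * |D| ≤ X * t) : |D| ≤ X / r := by
  rcases ht.eq_or_lt with h1 | h1
  · rw [h0 h1.symm, abs_zero]
    positivity
  · rw [le_div_iff₀ hr]
    nlinarith

/-- Two nonnegative quadratic forms with nearby coefficients have nearby square roots. -/
theorem abs_sqrt_bilin_sub_le {r δ : ℝ} (hr : 0 < r) {A B : V →L[ℝ] V →L[ℝ] ℝ} {v : V}
    (hA : r ^ 2 * ‖v‖ ^ 2 ≤ A v v) (hB : r ^ 2 * ‖v‖ ^ 2 ≤ B v v) (hAB : ‖A - B‖ ≤ δ) :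
    |√(A v v) - √(B v v)| ≤ δ * ‖v‖ / r := by
  have hδ : 0 ≤ δ := (norm_nonneg (A - B)).trans hAB
  have hA0 : 0 ≤ A v v := le_trans (by positivity) hA
  have hB0 : 0 ≤ B v v := le_trans (by positivity) hB
  refine le_div_of_mul_self_bound hr (norm_nonneg v) ?_ (by positivity) ?_
  · intro h
    rw [norm_eq_zero] at h
    simp [h]
  · have h1 := mul_norm_le_sqrt_bilin hA
    have h2 := mul_norm_le_sqrt_bilin hB
    have h3 : (√(A v v) + √(B v v)) * |√(A v v) - √(B v v)| = |(A - B) v v| := by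
      rw [← abs_of_nonneg (add_nonneg (Real.sqrt_nonneg (A v v)) (Real.sqrt_nonneg (B v v))),
        ← abs_mul]
      congr 1
      have e1 := Real.mul_self_sqrt hA0
      have e2 := Real.mul_self_sqrt hB0
      simp only [_root_.sub_apply]
      linear_combination e1 - e2
    have h4 : |(A - B) v v| ≤ δ * ‖v‖ * ‖v‖ := by
      refine ((A - B).le_opNorm₂ v v).trans ?_
      gcongr
    rw [← h3] at h4
    refine le_trans ?_ h4
    gcongr
    linarith [Real.sqrt_nonneg (B v v)]

theorem abs_sqrt_bilin_self_sub_le {r : ℝ} (hr : 0 < r) {B : V →L[ℝ] V →L[ℝ] ℝ}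
    (hB : ∀ v, r ^ 2 * ‖v‖ ^ 2 ≤ B v v) (u v : V) :
    |√(B u u) - √(B v v)| ≤ ‖B‖ * ‖u - v‖ / r := by
  have hB0 : ∀ v, 0 ≤ B v v := fun v => le_trans (by positivity) (hB v)
  refine le_div_of_mul_self_bound hr (add_nonneg (norm_nonneg u) (norm_nonneg v)) ?_
    (by positivity) ?_
  · intro h
    have hu : u = 0 := norm_eq_zero.1 (by linarith [norm_nonneg u, norm_nonneg v])
    have hv : v = 0 := norm_eq_zero.1 (by linarith [norm_nonneg u, norm_nonneg v])
    simp [hu, hv]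
  · have h1 := mul_norm_le_sqrt_bilin (hB u)
    have h2 := mul_norm_le_sqrt_bilin (hB v)
    have h3 : (√(B u u) + √(B v v)) * |√(B u u) - √(B v v)| = |B u u - B v v| := by
      rw [← abs_of_nonneg (add_nonneg (Real.sqrt_nonneg (B u u)) (Real.sqrt_nonneg (B v v))),
        ← abs_mul]
      congr 1
      have e1 := Real.mul_self_sqrt (hB0 u)
      have e2 := Real.mul_self_sqrt (hB0 v)
      linear_combination e1 - e2
    refine le_trans ?_ (h3.le.trans (abs_bilin_self_sub_le B u v))
    gcongr
    linarith

/-- Multiplying by √(A₁ u u) + √(A₂ v v) ≥ r(‖u‖ + ‖v‖) removes the roots of the varying forms.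
Every resulting term carries a factor δ, from ‖u‖ ≤ δ or from ‖Aᵢ - B‖ ≤ δ, and a factor d, so the
Lipschitz constant is O(δ). -/
theorem abs_sqrt_bilin_sub_sub_le {r δ K l d : ℝ} (hr : 0 < r) (hK : 0 ≤ K) (hl : 0 ≤ l)
    (hd : 0 ≤ d) {A₁ A₂ B : V →L[ℝ] V →L[ℝ] ℝ} {u v : V}
    (hB : ∀ v, r ^ 2 * ‖v‖ ^ 2 ≤ B v v)
    (hA₁ : r ^ 2 * ‖u‖ ^ 2 ≤ A₁ u u) (hA₂ : r ^ 2 * ‖v‖ ^ 2 ≤ A₂ v v)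
    (hAB₁ : ‖A₁ - B‖ ≤ δ) (hAB₂ : ‖A₂ - B‖ ≤ δ) (hA : ‖A₁ - A₂‖ ≤ K * d)
    (huv : ‖u - v‖ ≤ l * d) (hu : ‖u‖ ≤ δ) :
    |(√(A₁ u u) - √(B u u)) - (√(A₂ v v) - √(B v v))| ≤
      δ * (K + l + ‖B‖ * l / r ^ 2) * d / r := by
  have hδ : 0 ≤ δ := (norm_nonneg (A₁ - B)).trans hAB₁
  have p1 := Real.mul_self_sqrt (le_trans (by positivity) hA₁)
  have p2 := Real.mul_self_sqrt (le_trans (by positivity) hA₂)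
  have p3 := Real.mul_self_sqrt (le_trans (by positivity) (hB u))
  have p4 := Real.mul_self_sqrt (le_trans (by positivity) (hB v))
  refine le_div_of_mul_self_bound hr (add_nonneg (norm_nonneg u) (norm_nonneg v)) ?_
    (by positivity) ?_
  · intro h
    have hu : u = 0 := norm_eq_zero.1 (by linarith [norm_nonneg u, norm_nonneg v])
    have hv : v = 0 := norm_eq_zero.1 (by linarith [norm_nonneg u, norm_nonneg v])
    simp [hu, hv]
  have h1 := mul_norm_le_sqrt_bilin hA₁
  have h2 := mul_norm_le_sqrt_bilin hA₂
  have e1 := abs_sqrt_bilin_sub_le hr hA₁ (hB u) hAB₁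
  have e2 := abs_sqrt_bilin_sub_le hr hA₂ (hB v) hAB₂
  have e3 : |√(B u u) - √(B v v)| ≤ ‖B‖ * (l * d) / r :=
    (abs_sqrt_bilin_self_sub_le hr hB u v).trans (by gcongr)
  have e4 : |(A₁ - A₂) u u| ≤ (K * d) * δ * (‖u‖ + ‖v‖) := by
    refine ((A₁ - A₂).le_opNorm₂ u u).trans ?_
    gcongr
    linarith [norm_nonneg v]
  have e5 : |(A₂ - B) u u - (A₂ - B) v v| ≤ δ * (l * d) * (‖u‖ + ‖v‖) :=
    (abs_bilin_self_sub_le (A₂ - B) u v).trans (by gcongr)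
  set N₁ := √(A₁ u u)
  set N₂ := √(A₂ v v)
  set M₁ := √(B u u)
  set M₂ := √(B v v)
  -- The first two terms equal N₁² - M₁² - N₂² + M₂²; the last corrects for multiplying the
  -- M-difference by N₁ + N₂ instead of M₁ + M₂.
  have key : (N₁ + N₂) * ((N₁ - M₁) - (N₂ - M₂)) =
      (A₁ - A₂) u u + ((A₂ - B) u u - (A₂ - B) v v) -
        ((N₁ - M₁) + (N₂ - M₂)) * (M₁ - M₂) := by
    simp only [_root_.sub_apply]
    linear_combination p1 - p2 - p3 + p4
  have hN : 0 ≤ N₁ + N₂ := add_nonneg (Real.sqrt_nonneg _) (Real.sqrt_nonneg _)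
  have e6 : |((N₁ - M₁) + (N₂ - M₂)) * (M₁ - M₂)| ≤
      (δ * ‖u‖ / r + δ * ‖v‖ / r) * (‖B‖ * (l * d) / r) := by
    rw [abs_mul]
    gcongr
    exact (abs_add_le _ _).trans (add_le_add e1 e2)
  calc r * (‖u‖ + ‖v‖) * |(N₁ - M₁) - (N₂ - M₂)|
      ≤ (N₁ + N₂) * |(N₁ - M₁) - (N₂ - M₂)| := by gcongr; linarith
    _ = |(N₁ + N₂) * ((N₁ - M₁) - (N₂ - M₂))| := by rw [abs_mul, abs_of_nonneg hN]
    _ ≤ (K * d) * δ * (‖u‖ + ‖v‖) + δ * (l * d) * (‖u‖ + ‖v‖) +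
        (δ * ‖u‖ / r + δ * ‖v‖ / r) * (‖B‖ * (l * d) / r) := by
        rw [key]
        exact (abs_sub _ _).trans (add_le_add ((abs_add_le _ _).trans (add_le_add e4 e5)) e6)
    _ = δ * (K + l + ‖B‖ * l / r ^ 2) * d * (‖u‖ + ‖v‖) := by
        field_simp

theorem hasStrictFDerivAt_sqrt_sub_sqrt_of_eq_zero {Q : E → V →L[ℝ] V →L[ℝ] ℝ}
    {Q' : E →L[ℝ] V →L[ℝ] V →L[ℝ] ℝ} {x₀ : E} (hQ : HasStrictFDerivAt Q Q' x₀) (L : E →L[ℝ] V)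
    (hL : L x₀ = 0) {r : ℝ} (hr : 0 < r) (hc : ∀ v, 2 * r ^ 2 * ‖v‖ ^ 2 ≤ Q x₀ v v) :
    HasStrictFDerivAt (fun x => √(Q x (L x) (L x)) - √(Q x₀ (L x) (L x)))
      (0 : E →L[ℝ] ℝ) x₀ := by
  obtain ⟨K, s, hs, hK⟩ := HasStrictFDerivAt.exists_lipschitzOnWith (𝕜 := ℝ)
    (E := E) (F := V →L[ℝ] V →L[ℝ] ℝ) hQ
  have hB : ∀ v, r ^ 2 * ‖v‖ ^ 2 ≤ Q x₀ v v := fun v =>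
    le_trans (by nlinarith [mul_nonneg (sq_nonneg r) (sq_nonneg ‖v‖)]) (hc v)
  rw [hasStrictFDerivAt_iff_isLittleO, Asymptotics.isLittleO_iff]
  intro c hc0
  set C : ℝ := K + ‖L‖ + ‖Q x₀‖ * ‖L‖ / r ^ 2 with hC
  have hC0 : 0 ≤ C := by positivity
  -- The bound r² costs half of the coercivity 2r², leaving r² for every nearby form; the other
  -- bound brings the Lipschitz constant δC/r below c, with C + 1 avoiding division by zero.
  set δ : ℝ := min (r ^ 2) (c * r / (C + 1)) with hδ
  have hδ0 : 0 < δ := lt_min (by positivity) (by positivity)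
  have hδ1 : δ ≤ r ^ 2 := min_le_left _ _
  have hδ2 : δ * C ≤ c * r := by
    have h1 : δ * (C + 1) ≤ c * r := by
      rw [← le_div_iff₀ (by positivity)]
      exact min_le_right _ _
    nlinarith
  have n1 : ∀ᶠ x in 𝓝 x₀, ‖Q x - Q x₀‖ ≤ δ := by
    have h := hQ.continuousAt.eventually (Metric.closedBall_mem_nhds (Q x₀) hδ0)
    filter_upwards [h] with x hx
    rw [← dist_eq_norm (E := V →L[ℝ] V →L[ℝ] ℝ)]
    exact hx
  have n2 : ∀ᶠ x in 𝓝 x₀, ‖L x‖ ≤ δ := by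
    have h := L.continuous.continuousAt.eventually (Metric.closedBall_mem_nhds (L x₀) hδ0)
    simpa [Metric.closedBall, dist_eq_norm, hL] using h
  have hco : ∀ {x}, ‖Q x - Q x₀‖ ≤ δ → ∀ v, r ^ 2 * ‖v‖ ^ 2 ≤ Q x v v := by
    intro x hx v
    have h1 := (abs_le.1 (((Q x - Q x₀).le_opNorm₂ v v).trans
      (by gcongr; exact hx.trans hδ1 : _ ≤ r ^ 2 * ‖v‖ * ‖v‖))).1
    simp only [_root_.sub_apply] at h1
    nlinarith [hc v]
  have n := (n1.and (n2.and hs)).prod_nhds (n1.and (n2.and hs))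
  filter_upwards [n] with p hp
  obtain ⟨⟨a1, a2, a3⟩, b1, b2, b3⟩ := hp
  have hA : ‖Q p.1 - Q p.2‖ ≤ K * ‖p.1 - p.2‖ := by
    simpa [dist_eq_norm] using hK.dist_le_mul _ a3 _ b3
  have huv : ‖L p.1 - L p.2‖ ≤ ‖L‖ * ‖p.1 - p.2‖ := by
    rw [← map_sub]; exact L.le_opNorm _
  have := abs_sqrt_bilin_sub_sub_le hr K.2 (norm_nonneg L) (norm_nonneg (p.1 - p.2)) hB
    (hco a1 (L p.1)) (hco b1 (L p.2)) a1 b1 hA huv a2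
  simp only [_root_.zero_apply, sub_zero, Real.norm_eq_abs]
  refine this.trans ?_
  rw [div_le_iff₀ hr]
  have := mul_le_mul_of_nonneg_right hδ2 (norm_nonneg (p.1 - p.2))
  calc _ = δ * C * ‖p.1 - p.2‖ := rfl
    _ ≤ _ := this.trans (le_of_eq (by ring))

/-- The error made by freezing the coefficients of `x ↦ √(Q x (L x) (L x))` at `x₀` is strictly
differentiable at `x₀`, also where `L x₀ = 0`. -/
theorem hasStrictFDerivAt_sqrt_sub_sqrt {Q : E → V →L[ℝ] V →L[ℝ] ℝ}
    {Q' : E →L[ℝ] V →L[ℝ] V →L[ℝ] ℝ} {x₀ : E} (hQ : HasStrictFDerivAt Q Q' x₀) (L : E →L[ℝ] V)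
    {r : ℝ} (hr : 0 < r) (hc : ∀ v, 2 * r ^ 2 * ‖v‖ ^ 2 ≤ Q x₀ v v) :
    HasStrictFDerivAt (fun x => √(Q x (L x) (L x)) - √(Q x₀ (L x) (L x)))
      ((1 / (2 * √(Q x₀ (L x₀) (L x₀)))) • ((Q'.flip (L x₀)).flip (L x₀))) x₀ := by
  by_cases hL : L x₀ = 0
  -- Here the claimed derivative is zero, the form being evaluated at L x₀ = 0.
  · simpa [hL] using hasStrictFDerivAt_sqrt_sub_sqrt_of_eq_zero hQ L hL hr hc
  have hq : Q x₀ (L x₀) (L x₀) ≠ 0 := by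
    have h1 := hc (L x₀)
    have h2 : 0 < ‖L x₀‖ := norm_pos_iff.2 hL
    have h3 : 0 < 2 * r ^ 2 * ‖L x₀‖ ^ 2 := by positivity
    linarith
  have hQL := ((hQ.clm_apply L.hasStrictFDerivAt).clm_apply L.hasStrictFDerivAt).sqrt hq
  have hQL₀ := ((((hasStrictFDerivAt_const (Q x₀) x₀).clm_apply
    L.hasStrictFDerivAt).clm_apply L.hasStrictFDerivAt)).sqrt hq
  -- The contributions from differentiating L agree in both roots and cancel; only the derivative of
  -- Q remains.
  refine (hQL.sub hQL₀).congr_fderiv ?_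
  ext v
  simp

end QuadraticForms

/-! ### The model function and `Ψ_γ` near a point where the Gram matrix is invertible -/

theorem isMoorePenrose_inv {n : ℕ} {A : Matrix (Fin n) (Fin n) ℝ} (hA : IsUnit A) :
    IsMoorePenrose A A⁻¹ := by
  have h : IsUnit A.det := (isUnit_iff_isUnit_det A).1 hA
  constructor <;> simp [mul_nonsing_inv _ h, nonsing_inv_mul _ h]

theorem pinv_eq_inv {n : ℕ} {A : Matrix (Fin n) (Fin n) ℝ} (hA : IsUnit A) : pinv A = A⁻¹ :=
  (pinv_spec A).unique (isMoorePenrose_inv hA)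

/-- Since √W is symmetric with square W, ‖zᵀ√W‖² = zᵀWz. This links Ψ_γ to weighted norms and
exhibits them as a norm composed with a linear map, hence convex. -/
theorem norm_vecMul_sqrt_eq_weightedNorm {K : ℕ} {W : Matrix (Fin K) (Fin K) ℝ}
    (hW : W.PosSemidef) (z : Fin K → ℝ) :
    ‖WithLp.toLp 2 (z ᵥ* CFC.sqrt W)‖ = weightedNorm W z := by
  have hs : (CFC.sqrt W)ᵀ = CFC.sqrt W := by
    have h : (CFC.sqrt W).PosSemidef := (CFC.sqrt_nonneg W).posSemidef
    simpa using h.isHermitian.eq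
  have hm : CFC.sqrt W * CFC.sqrt W = W := CFC.sqrt_mul_sqrt_self W hW.nonneg
  rw [EuclideanSpace.norm_eq, weightedNorm]
  congr 1
  have h1 : z ⬝ᵥ (W *ᵥ z) = (z ᵥ* CFC.sqrt W) ⬝ᵥ (z ᵥ* CFC.sqrt W) := by
    conv_lhs => rw [← hm]
    rw [← mulVec_mulVec, dotProduct_mulVec]
    congr 1
    conv_lhs => rw [← hs]
    rw [mulVec_transpose]
  rw [h1]
  simp [dotProduct, sq]

theorem convexOn_weightedNorm {K : ℕ} {W : Matrix (Fin K) (Fin K) ℝ} (hW : W.PosSemidef) :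
    ConvexOn ℝ Set.univ (weightedNorm W) := by
  have h := (convexOn_univ_norm (E := EuclideanSpace ℝ (Fin K))).comp_linearMap
    ((WithLp.linearEquiv 2 ℝ (Fin K → ℝ)).symm.toLinearMap ∘ₗ (CFC.sqrt W).vecMulLinear)
  have e : weightedNorm W = norm ∘ ⇑((WithLp.linearEquiv 2 ℝ (Fin K → ℝ)).symm.toLinearMap ∘ₗ
      (CFC.sqrt W).vecMulLinear) :=
    funext fun z => (norm_vecMul_sqrt_eq_weightedNorm hW z).symm
  rw [e]
  exact h

theorem posSemidef_gramMatrix {N K : ℕ} {γ : ℝ} (hγ : γ ∈ Set.Icc (0 : ℝ) 1)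
    (Z : Matrix (Fin N) (Fin K) ℝ) : (gramMatrix γ Z).PosSemidef := by
  have h : (Zᵀ * Z).PosSemidef := by simpa using posSemidef_conjTranspose_mul_self Z
  exact (PosSemidef.one.smul hγ.1).add (h.smul (sub_nonneg.2 hγ.2))

theorem Psi_eq_weightedRowSum {N K : ℕ} {γ : ℝ} (hγ : γ ∈ Set.Icc (0 : ℝ) 1)
    {Z : Matrix (Fin N) (Fin K) ℝ} (hZ : IsUnit (gramMatrix γ Z)) :
    Psi γ Z = weightedRowSum (gramMatrix γ Z)⁻¹ Z := by
  have hW := (posSemidef_gramMatrix hγ Z).inv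
  rw [Psi, pinvSqrt, pinv_eq_inv hZ, l21Norm, weightedRowSum]
  refine Finset.sum_congr rfl fun n _ => ?_
  rw [← norm_vecMul_sqrt_eq_weightedNorm hW]
  rfl

theorem convexOn_weightedRowSum {N K : ℕ} {W : Matrix (Fin K) (Fin K) ℝ} (hW : W.PosSemidef) :
    ConvexOn ℝ Set.univ (weightedRowSum (N := N) W) := by
  have h : ∀ s : Finset (Fin N), ConvexOn ℝ Set.univ
      (fun Z : Matrix (Fin N) (Fin K) ℝ => ∑ n ∈ s, weightedNorm W (Z n)) := by
    intro s
    induction s using Finset.induction_on with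
    | empty => simpa using convexOn_const (0 : ℝ) convex_univ
    | insert a s ha ih =>
      simp only [Finset.sum_insert ha]
      exact ((convexOn_weightedNorm hW).comp_linearMap
        (LinearMap.proj a : (Fin N → Fin K → ℝ) →ₗ[ℝ] (Fin K → ℝ))).add ih
  exact h Finset.univ

/-- The trace inner product with a fixed matrix, as a linear functional. -/
noncomputable def traceInnerLinear {N K : ℕ} (G : Matrix (Fin N) (Fin K) ℝ) :
    Matrix (Fin N) (Fin K) ℝ →ₗ[ℝ] ℝ where
  toFun := traceInner G
  map_add' A B := by simp [traceInner, Matrix.mul_add]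
  map_smul' c A := by simp [traceInner]

theorem traceInnerLinear_apply {N K : ℕ} (G V : Matrix (Fin N) (Fin K) ℝ) :
    traceInnerLinear G V = traceInner G V := rfl

theorem convexOn_modelPsi {N K : ℕ} {γ : ℝ} (hγ : γ ∈ Set.Icc (0 : ℝ) 1)
    (Zh : Matrix (Fin N) (Fin K) ℝ) : ConvexOn ℝ Set.univ (modelPsi γ Zh) := by
  refine (convexOn_weightedRowSum (posSemidef_gramMatrix hγ Zh).inv).add ?_
  have h := ((traceInnerLinear (Zh * lambdaHat γ Zh)).convexOn convex_univ).add_const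
    (-traceInner (Zh * lambdaHat γ Zh) Zh)
  have e : (fun Z => traceInner (Zh * lambdaHat γ Zh) (Z - Zh)) =
      ⇑(traceInnerLinear (Zh * lambdaHat γ Zh)) +
        fun _ => -traceInner (Zh * lambdaHat γ Zh) Zh := by
    funext Z
    simp only [← traceInnerLinear_apply, Pi.add_apply]
    rw [map_sub, sub_eq_add_neg]
  rw [e]
  exact h

/-! ### Differentiability with respect to the Frobenius norm -/

noncomputable section

attribute [local instance] Matrix.frobeniusNormedAddCommGroup Matrix.frobeniusNormedSpace
  Matrix.frobeniusNormedRing Matrix.frobeniusNormedAlgebra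

variable {N K : ℕ}

theorem frobNorm_eq_norm (A : Matrix (Fin N) (Fin K) ℝ) : frobNorm A = ‖A‖ := by
  rw [frobNorm, frobenius_norm_def, Real.sqrt_eq_rpow, traceInner, trace]
  congr 1
  rw [Finset.sum_comm]
  simp [Matrix.mul_apply, sq]

/-- The bilinear form `(u, v) ↦ uᵀ W v`, depending linearly on `W`. -/
def bilinForm (K : ℕ) : Matrix (Fin K) (Fin K) ℝ →L[ℝ] (Fin K → ℝ) →L[ℝ] (Fin K → ℝ) →L[ℝ] ℝ :=
  LinearMap.toContinuousLinearMap (F' := (Fin K → ℝ) →L[ℝ] (Fin K → ℝ) →L[ℝ] ℝ)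
    { toFun := fun W => (Matrix.toLinearMap₂' ℝ W).toContinuousBilinearMap
      map_add' := fun A B => by
        refine ContinuousLinearMap.ext fun u => ContinuousLinearMap.ext fun v => ?_
        simp
      map_smul' := fun c A => by
        refine ContinuousLinearMap.ext fun u => ContinuousLinearMap.ext fun v => ?_
        simp }

theorem bilinForm_apply (W : Matrix (Fin K) (Fin K) ℝ) (u v : Fin K → ℝ) :
    bilinForm K W u v = u ⬝ᵥ (W *ᵥ v) :=
  Matrix.toLinearMap₂'_apply' W u v

/-- The bilinear map `(A, B) ↦ Aᵀ B`. -/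
def transposeMul (N K : ℕ) : Matrix (Fin N) (Fin K) ℝ →L[ℝ] Matrix (Fin N) (Fin K) ℝ →L[ℝ]
    Matrix (Fin K) (Fin K) ℝ :=
  (LinearMap.mk₂ ℝ (fun A B : Matrix (Fin N) (Fin K) ℝ => Aᵀ * B)
    (fun A B C => by simp [Matrix.add_mul]) (fun c A B => by simp)
    (fun A B C => by simp [Matrix.mul_add]) (fun c A B => by simp)).toContinuousBilinearMap

/-- The derivative of `gramMatrix γ` at `Z`. -/
def gramDeriv (γ : ℝ) (Z : Matrix (Fin N) (Fin K) ℝ) :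
    Matrix (Fin N) (Fin K) ℝ →L[ℝ] Matrix (Fin K) (Fin K) ℝ :=
  LinearMap.toContinuousLinearMap
    { toFun := fun V => (1 - γ) • (Zᵀ * V + Vᵀ * Z)
      map_add' := fun A B => by
        simp only [Matrix.mul_add, Matrix.add_mul, transpose_add, ← smul_add]
        congr 1
        abel
      map_smul' := fun c A => by
        simp [smul_comm c] }

theorem gramDeriv_apply (γ : ℝ) (Z V : Matrix (Fin N) (Fin K) ℝ) :
    gramDeriv γ Z V = (1 - γ) • (Zᵀ * V + Vᵀ * Z) := rfl

theorem hasStrictFDerivAt_gramMatrix (γ : ℝ) (Z : Matrix (Fin N) (Fin K) ℝ) :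
    HasStrictFDerivAt (gramMatrix (N := N) (K := K) γ) (gramDeriv γ Z) Z := by
  have h := (transposeMul N K).hasStrictFDerivAt_of_bilinear
    (hasStrictFDerivAt_id Z) (hasStrictFDerivAt_id Z)
  refine ((h.const_smul (1 - γ)).const_add (γ • (1 : Matrix (Fin K) (Fin K) ℝ))).congr_fderiv ?_
  refine ContinuousLinearMap.ext fun V => ?_
  rfl

/-- The derivative of matrix inversion at `W⁻¹`. -/
def invDeriv (W : Matrix (Fin K) (Fin K) ℝ) :
    Matrix (Fin K) (Fin K) ℝ →L[ℝ] Matrix (Fin K) (Fin K) ℝ :=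
  LinearMap.toContinuousLinearMap
    { toFun := fun T => -(W * T * W)
      map_add' := fun A B => by simp [Matrix.mul_add, Matrix.add_mul, add_comm]
      map_smul' := fun c A => by simp }

theorem invDeriv_apply (W T : Matrix (Fin K) (Fin K) ℝ) : invDeriv W T = -(W * T * W) := rfl

theorem hasStrictFDerivAt_inv_gramMatrix {γ : ℝ} {Z : Matrix (Fin N) (Fin K) ℝ}
    (hM : IsUnit (gramMatrix γ Z)) :
    HasStrictFDerivAt (fun Z => (gramMatrix (N := N) (K := K) γ Z)⁻¹)
      ((invDeriv (gramMatrix γ Z)⁻¹).comp (gramDeriv γ Z)) Z := by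
  obtain ⟨u, hu⟩ := hM
  have h := hasStrictFDerivAt_ringInverse (𝕜 := ℝ) u
  have e : ((u⁻¹ : (Matrix (Fin K) (Fin K) ℝ)ˣ) : Matrix (Fin K) (Fin K) ℝ) =
      (gramMatrix γ Z)⁻¹ := by
    rw [← hu, coe_units_inv]
  rw [e, hu] at h
  have h2 : HasStrictFDerivAt Ring.inverse (invDeriv (gramMatrix γ Z)⁻¹) (gramMatrix γ Z) :=
    h.congr_fderiv (ContinuousLinearMap.ext fun T => rfl)
  simp only [nonsing_inv_eq_ringInverse] at *
  exact h2.comp Z (hasStrictFDerivAt_gramMatrix γ Z)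

/-- The map v ↦ vᵀ√W is injective on a finite-dimensional space, hence bounded below. -/
theorem exists_coercive_of_posDef {W : Matrix (Fin K) (Fin K) ℝ} (hW : W.PosDef) :
    ∃ r : ℝ, 0 < r ∧ ∀ v : Fin K → ℝ, 2 * r ^ 2 * ‖v‖ ^ 2 ≤ v ⬝ᵥ (W *ᵥ v) := by
  set f : (Fin K → ℝ) →ₗ[ℝ] EuclideanSpace ℝ (Fin K) :=
    (WithLp.linearEquiv 2 ℝ (Fin K → ℝ)).symm.toLinearMap ∘ₗ (CFC.sqrt W).vecMulLinear with hf
  have hfn : ∀ v, ‖f v‖ ^ 2 = v ⬝ᵥ (W *ᵥ v) := by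
    intro v
    have h0 : 0 ≤ v ⬝ᵥ (W *ᵥ v) := by simpa using hW.posSemidef.dotProduct_mulVec_nonneg v
    have h : ‖f v‖ = weightedNorm W v := norm_vecMul_sqrt_eq_weightedNorm hW.posSemidef v
    rw [h, weightedNorm, Real.sq_sqrt h0]
  have hker : LinearMap.ker f = ⊥ := by
    rw [LinearMap.ker_eq_bot']
    intro v hv
    by_contra hne
    have h1 := hfn v
    have h2 : 0 < v ⬝ᵥ (W *ᵥ v) := by simpa using hW.dotProduct_mulVec_pos hne
    rw [hv] at h1
    simp at h1
    linarith
  obtain ⟨C, hC, hA⟩ := f.exists_antilipschitzWith hker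
  have hC' : (0 : ℝ) < C := hC
  -- With this r, 2r²C² = 1/2, which is more than enough.
  refine ⟨1 / (2 * C), by positivity, fun v => ?_⟩
  have h1 : ‖v‖ ≤ C * ‖f v‖ := by simpa using hA.le_mul_dist v 0
  rw [← hfn]
  have h2 : ‖v‖ ^ 2 ≤ (C * ‖f v‖) ^ 2 := by gcongr
  have h3 : 2 * (1 / (2 * (C : ℝ))) ^ 2 * (C * ‖f v‖) ^ 2 = ‖f v‖ ^ 2 / 2 := by
    field_simp
  calc _ ≤ 2 * (1 / (2 * (C : ℝ))) ^ 2 * (C * ‖f v‖) ^ 2 := by gcongr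
    _ ≤ _ := by rw [h3]; linarith [sq_nonneg ‖f v‖]

/-- The `n`-th row of a matrix, as a continuous linear map. -/
def rowProj (n : Fin N) : Matrix (Fin N) (Fin K) ℝ →L[ℝ] (Fin K → ℝ) :=
  LinearMap.toContinuousLinearMap
    { toFun := fun Z => Z n
      map_add' := fun _ _ => rfl
      map_smul' := fun _ _ => rfl }

theorem posDef_inv_gramMatrix {γ : ℝ} (hγ : γ ∈ Set.Icc (0 : ℝ) 1)
    {Z : Matrix (Fin N) (Fin K) ℝ} (hM : IsUnit (gramMatrix γ Z)) : (gramMatrix γ Z)⁻¹.PosDef :=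
  (((posSemidef_gramMatrix hγ Z).posDef_iff_isUnit).2 hM).inv

/-- Λ̂ is designed for this identity. By symmetry of Ŵ the two halves ZᵀV and VᵀZ of the Gram
derivative give equal quadratic forms, which cancels the 1/2 from differentiating the root. Rows
with zₙ = 0 vanish on both sides. -/
theorem traceInner_lambdaHat (γ : ℝ) (Z V : Matrix (Fin N) (Fin K) ℝ)
    (hs : (gramMatrix γ Z)⁻¹ᵀ = (gramMatrix γ Z)⁻¹) :
    traceInner (Z * lambdaHat γ Z) V = ∑ n, 1 / (2 * weightedNorm (gramMatrix γ Z)⁻¹ (Z n)) *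
      (Z n ⬝ᵥ (invDeriv (gramMatrix γ Z)⁻¹ (gramDeriv γ Z V) *ᵥ Z n)) := by
  have hterm : ∀ n, traceInner (Z * ((gramMatrix γ Z)⁻¹ * vecMulVec (Z n) (Z n) *
      (gramMatrix γ Z)⁻¹)) V =
      Z n ⬝ᵥ (((gramMatrix γ Z)⁻¹ * (Zᵀ * V) * (gramMatrix γ Z)⁻¹) *ᵥ Z n) := by
    intro n
    set W := (gramMatrix γ Z)⁻¹
    rw [traceInner]
    simp only [transpose_mul, transpose_vecMulVec, hs]
    have h : ∀ A : Matrix (Fin K) (Fin K) ℝ,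
        (vecMulVec (Z n) (Z n) * A).trace = Z n ⬝ᵥ (A *ᵥ Z n) := by
      intro A
      rw [vecMulVec_mul, trace_vecMulVec, dotProduct_mulVec, dotProduct_comm]
    rw [← h]
    have e : W * (vecMulVec (Z n) (Z n) * W) * Zᵀ * V =
        W * (vecMulVec (Z n) (Z n) * (W * (Zᵀ * V))) := by
      simp only [Matrix.mul_assoc]
    rw [e, trace_mul_comm]
    simp only [Matrix.mul_assoc]
  have hsym : ∀ n, Z n ⬝ᵥ (((gramMatrix γ Z)⁻¹ * (Vᵀ * Z) * (gramMatrix γ Z)⁻¹) *ᵥ Z n) =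
      Z n ⬝ᵥ (((gramMatrix γ Z)⁻¹ * (Zᵀ * V) * (gramMatrix γ Z)⁻¹) *ᵥ Z n) := by
    intro n
    rw [dotProduct_mulVec, dotProduct_comm, ← mulVec_transpose]
    simp only [transpose_mul, transpose_transpose, hs, Matrix.mul_assoc]
  have hexp : traceInner (Z * lambdaHat γ Z) V = ∑ n,
      -(((1 - γ) / weightedNorm (gramMatrix γ Z)⁻¹ (Z n)) *
        traceInner (Z * ((gramMatrix γ Z)⁻¹ * vecMulVec (Z n) (Z n) * (gramMatrix γ Z)⁻¹)) V) := by
    rw [traceInner, lambdaHat, Matrix.mul_neg, Matrix.mul_sum, transpose_neg, transpose_sum,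
      Matrix.neg_mul, Matrix.sum_mul, trace_neg, trace_sum, Finset.sum_neg_distrib]
    simp [traceInner]
  rw [hexp]
  refine Finset.sum_congr rfl fun n _ => ?_
  rw [hterm, invDeriv_apply, gramDeriv_apply, Matrix.mul_smul, Matrix.smul_mul, Matrix.mul_add,
    Matrix.add_mul, neg_mulVec, dotProduct_neg, smul_mulVec, dotProduct_smul, add_mulVec,
    dotProduct_add, hsym, smul_eq_mul]
  ring

theorem exists_hasStrictFDerivAt_weightedNorm_sub {γ : ℝ} (hγ : γ ∈ Set.Icc (0 : ℝ) 1)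
    {Zh : Matrix (Fin N) (Fin K) ℝ} (hM : IsUnit (gramMatrix γ Zh)) (n : Fin N) :
    ∃ D : Matrix (Fin N) (Fin K) ℝ →L[ℝ] ℝ,
      HasStrictFDerivAt (fun Z : Matrix (Fin N) (Fin K) ℝ =>
        weightedNorm (gramMatrix γ Z)⁻¹ (Z n) - weightedNorm (gramMatrix γ Zh)⁻¹ (Z n)) D Zh ∧
      ∀ V, D V = 1 / (2 * weightedNorm (gramMatrix γ Zh)⁻¹ (Zh n)) *
        (Zh n ⬝ᵥ (invDeriv (gramMatrix γ Zh)⁻¹ (gramDeriv γ Zh V) *ᵥ Zh n)) := by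
  obtain ⟨r, hr, hc⟩ := exists_coercive_of_posDef (posDef_inv_gramMatrix hγ hM)
  have hB : HasStrictFDerivAt (bilinForm K) (bilinForm K) (gramMatrix γ Zh)⁻¹ :=
    ContinuousLinearMap.hasStrictFDerivAt (F := (Fin K → ℝ) →L[ℝ] (Fin K → ℝ) →L[ℝ] ℝ) _
  have hQ := HasStrictFDerivAt.comp (G := (Fin K → ℝ) →L[ℝ] (Fin K → ℝ) →L[ℝ] ℝ) Zh hB
    (hasStrictFDerivAt_inv_gramMatrix hM)
  have h := hasStrictFDerivAt_sqrt_sub_sqrt hQ (rowProj n) hr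
    (fun v => (hc v).trans_eq (bilinForm_apply _ v v).symm)
  have hw : ∀ (W : Matrix (Fin K) (Fin K) ℝ) (v : Fin K → ℝ),
      √(bilinForm K W v v) = weightedNorm W v := fun W v => by
    rw [bilinForm_apply, weightedNorm]
  refine ⟨_, h.congr_of_eventuallyEq (Eventually.of_forall fun Z => ?_), fun V => ?_⟩
  · exact congrArg₂ _ (hw _ _) (hw _ _)
  · exact congrArg₂ (fun a b => 1 / (2 * a) * b) (hw _ _) (bilinForm_apply _ _ _)

theorem hasStrictFDerivAt_Psi_sub_modelPsi {γ : ℝ} (hγ : γ ∈ Set.Icc (0 : ℝ) 1)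
    {Zh : Matrix (Fin N) (Fin K) ℝ} (hM : IsUnit (gramMatrix γ Zh)) :
    HasStrictFDerivAt (fun Z => Psi γ Z - modelPsi γ Zh Z)
      (0 : Matrix (Fin N) (Fin K) ℝ →L[ℝ] ℝ) Zh := by
  choose D hD hDV using exists_hasStrictFDerivAt_weightedNorm_sub hγ hM
  have hsum := HasStrictFDerivAt.fun_sum (u := Finset.univ) fun n _ => hD n
  have hlin := ((LinearMap.toContinuousLinearMap (traceInnerLinear (Zh * lambdaHat γ Zh))
    ).hasStrictFDerivAt (x := Zh)).sub_const (traceInner (Zh * lambdaHat γ Zh) Zh)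
  have hunit : ∀ᶠ Z in 𝓝 Zh, IsUnit (gramMatrix γ Z) :=
    (hasStrictFDerivAt_gramMatrix γ Zh).continuousAt.eventually (Units.isOpen.mem_nhds hM)
  refine ((hsum.fun_sub hlin).congr_fderiv ?_).congr_of_eventuallyEq ?_
  · refine ContinuousLinearMap.ext fun V => ?_
    have hs : (gramMatrix γ Zh)⁻¹ᵀ = (gramMatrix γ Zh)⁻¹ := by
      simpa using (posDef_inv_gramMatrix hγ hM).isHermitian.eq
    have hV : (∑ n, D n) V = ∑ n, D n V := _root_.sum_apply _ _ _
    refine sub_eq_zero.2 (hV.trans ?_)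
    exact (Finset.sum_congr rfl fun n _ => hDV n V).trans (traceInner_lambdaHat γ Zh V hs).symm
  · filter_upwards [hunit] with Z hZ
    have h : traceInner (Zh * lambdaHat γ Zh) (Z - Zh) =
        traceInner (Zh * lambdaHat γ Zh) Z - traceInner (Zh * lambdaHat γ Zh) Zh :=
      map_sub (traceInnerLinear (Zh * lambdaHat γ Zh)) Z Zh
    rw [Psi_eq_weightedRowSum hγ hZ, modelPsi, weightedRowSum, weightedRowSum, ← sub_sub,
      ← Finset.sum_sub_distrib, h]
    rfl

/-! ### Clarke subdifferentials -/

/-- A strictly differentiable function and a finite convex function in finite dimension are both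
locally Lipschitz, hence so is their sum. -/
theorem isLipschitzNear_of_hasStrictFDerivAt_sub {f m : Matrix (Fin N) (Fin K) ℝ → ℝ}
    {h' : Matrix (Fin N) (Fin K) ℝ →L[ℝ] ℝ} {Z : Matrix (Fin N) (Fin K) ℝ}
    (hm : ConvexOn ℝ Set.univ m) (hfm : HasStrictFDerivAt (fun Y => f Y - m Y) h' Z) :
    IsLipschitzNear f Z := by
  obtain ⟨C₁, s, hs, h₁⟩ := hfm.exists_lipschitzOnWith
  obtain ⟨C₂, t, ht, h₂⟩ := ConvexOn.locallyLipschitz hm Z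
  refine ⟨C₁ + C₂, s ∩ t, inter_mem hs ht, fun Z₁ hZ₁ Z₂ hZ₂ => ?_⟩
  have e₁ := h₁.dist_le_mul _ hZ₁.1 _ hZ₂.1
  have e₂ := h₂.dist_le_mul _ hZ₁.2 _ hZ₂.2
  rw [Real.dist_eq, dist_eq_norm] at e₁ e₂
  rw [frobNorm_eq_norm, add_mul]
  have e : f Z₁ - f Z₂ = (f Z₁ - m Z₁ - (f Z₂ - m Z₂)) + (m Z₁ - m Z₂) := by ring
  rw [e]
  exact (abs_add_le _ _).trans (add_le_add e₁ e₂)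

theorem tendsto_clarke_pair (Z V : Matrix (Fin N) (Fin K) ℝ) :
    Tendsto (fun p : Matrix (Fin N) (Fin K) ℝ × ℝ => (p.1 + p.2 • V, p.1))
      (𝓝 Z ×ˢ 𝓝[>] (0 : ℝ)) (𝓝 (Z, Z)) := by
  have h : Tendsto (fun p : Matrix (Fin N) (Fin K) ℝ × ℝ => (p.1 + p.2 • V, p.1))
      (𝓝 (Z, 0)) (𝓝 (Z + (0 : ℝ) • V, Z)) :=
    Continuous.tendsto (by fun_prop) (Z, (0 : ℝ))
  rw [zero_smul, add_zero, nhds_prod_eq] at h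
  exact h.mono_left (Filter.prod_mono le_rfl nhdsWithin_le_nhds)

/-- The difference quotients of a function whose strict derivative vanishes are small. -/
theorem eventually_abs_le_of_hasStrictFDerivAt_zero {h : Matrix (Fin N) (Fin K) ℝ → ℝ}
    {Z : Matrix (Fin N) (Fin K) ℝ}
    (hh : HasStrictFDerivAt h (0 : Matrix (Fin N) (Fin K) ℝ →L[ℝ] ℝ) Z)
    (V : Matrix (Fin N) (Fin K) ℝ) {ε : ℝ} (hε : 0 < ε) :
    ∀ᶠ p : Matrix (Fin N) (Fin K) ℝ × ℝ in 𝓝 Z ×ˢ 𝓝[>] (0 : ℝ),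
      |h (p.1 + p.2 • V) - h p.1| ≤ ε * p.2 := by
  have hc : 0 < ε / (‖V‖ + 1) := by positivity
  have h1 := (Asymptotics.isLittleO_iff.1 hh.isLittleO hc)
  have h2 := (tendsto_clarke_pair Z V).eventually h1
  have h3 : ∀ᶠ p : Matrix (Fin N) (Fin K) ℝ × ℝ in 𝓝 Z ×ˢ 𝓝[>] (0 : ℝ), 0 < p.2 :=
    tendsto_snd.eventually self_mem_nhdsWithin
  filter_upwards [h2, h3] with p hp hp0
  have e : p.1 + p.2 • V - p.1 = p.2 • V := by abel
  simp only [e] at hp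
  change |h (p.1 + p.2 • V) - h p.1 - 0| ≤ _ at hp
  rw [sub_zero] at hp
  refine hp.trans ?_
  rw [norm_smul, Real.norm_eq_abs, abs_of_pos hp0, div_mul_eq_mul_div, div_le_iff₀ (by positivity)]
  have : 0 < ε * p.2 := by positivity
  nlinarith

theorem convex_quotient_le {E : Type*} [AddCommGroup E] [Module ℝ E] {m : E → ℝ}
    (hm : ConvexOn ℝ Set.univ m) (Y V : E) {t : ℝ} (ht : 0 < t) (ht1 : t ≤ 1) :
    m (Y + t • V) - m Y ≤ t * (m (Y + V) - m Y) := by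
  have h := hm.2 (Set.mem_univ Y) (Set.mem_univ (Y + V)) (sub_nonneg.2 ht1) ht.le (by ring)
  have e : (1 - t) • Y + t • (Y + V) = Y + t • V := by module
  rw [e, smul_eq_mul, smul_eq_mul] at h
  linarith

/-- If `f` differs from a convex function by a function whose strict derivative vanishes at `Z`,
then the Clarke subdifferential of `f` is the convex subdifferential. -/
theorem clarkeSubdifferential_eq_of_hasStrictFDerivAt_sub
    {f m : Matrix (Fin N) (Fin K) ℝ → ℝ} {Z : Matrix (Fin N) (Fin K) ℝ}
    (hm : ConvexOn ℝ Set.univ m)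
    (hfm : HasStrictFDerivAt (fun Y => f Y - m Y) (0 : Matrix (Fin N) (Fin K) ℝ →L[ℝ] ℝ) Z) :
    clarkeSubdifferential f Z = convexSubdifferential m Z := by
  have hcont : Continuous m := (ConvexOn.locallyLipschitz hm).continuous
  have hpos : ∀ᶠ p : Matrix (Fin N) (Fin K) ℝ × ℝ in 𝓝 Z ×ˢ 𝓝[>] (0 : ℝ), 0 < p.2 :=
    tendsto_snd.eventually self_mem_nhdsWithin
  have hone : ∀ᶠ p : Matrix (Fin N) (Fin K) ℝ × ℝ in 𝓝 Z ×ˢ 𝓝[>] (0 : ℝ), p.2 ≤ 1 :=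
    tendsto_snd.eventually (nhdsWithin_le_nhds (Iic_mem_nhds one_pos))
  ext G
  constructor
  · intro hG Y
    have hle : ∀ ε : ℝ, 0 < ε → traceInner G (Y - Z) ≤ m Y - m Z + ε := by
      intro ε hε
      have hm' : ∀ᶠ p : Matrix (Fin N) (Fin K) ℝ × ℝ in 𝓝 Z ×ˢ 𝓝[>] (0 : ℝ),
          m (p.1 + (Y - Z)) - m p.1 < m Y - m Z + ε / 2 := by
        refine tendsto_fst.eventually (p := fun X => m (X + (Y - Z)) - m X < m Y - m Z + ε / 2) ?_
        have h : ContinuousAt (fun X => m (X + (Y - Z)) - m X) Z :=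
          Continuous.continuousAt (by fun_prop)
        refine h.eventually (Iio_mem_nhds ?_)
        simp [hε]
      -- By convexity the quotient of m at base point X is at most m(X + V) - m(X) for t ≤ 1. This
      -- bound is free of t and continuous in X, so it survives the limsup.
      have hup : clarkeDeriv f Z (Y - Z) ≤ ((m Y - m Z + ε : ℝ) : EReal) := by
        refine limsup_le_of_le (by isBoundedDefault) ?_
        filter_upwards [hpos, hone, hm',
          eventually_abs_le_of_hasStrictFDerivAt_zero hfm (Y - Z) (half_pos hε)]
          with p h0 h1 h2 h3
        rw [EReal.coe_le_coe_iff, div_le_iff₀ h0]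
        have h4 := convex_quotient_le hm p.1 (Y - Z) h0 h1
        have h5 := (abs_le.1 h3).2
        nlinarith
      exact EReal.coe_le_coe_iff.1 ((hG (Y - Z)).trans hup)
    have := le_of_forall_pos_le_add hle
    linarith
  · intro hG V
    -- Comparing with real c above the limsup avoids arithmetic with its possibly infinite value.
    refine EReal.le_of_forall_lt_iff_le.1 fun c hc => ?_
    rw [EReal.coe_le_coe_iff]
    refine le_of_forall_pos_le_add fun ε hε => ?_
    -- The limsup dominates the quotients with base point fixed at Z, where the subgradient
    -- inequality applies.
    have hsub : Tendsto (fun t : ℝ => (Z, t)) (𝓝[>] 0) (𝓝 Z ×ˢ 𝓝[>] (0 : ℝ)) :=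
      tendsto_const_nhds.prodMk tendsto_id
    obtain ⟨t, h0, h1, h2⟩ := (hsub.eventually (hpos.and ((eventually_lt_of_limsup_lt hc).and
      (eventually_abs_le_of_hasStrictFDerivAt_zero hfm V hε)))).exists
    rw [EReal.coe_lt_coe_iff, div_lt_iff₀ h0] at h1
    have h3 := hG (Z + t • V)
    have h4 : traceInner G (Z + t • V - Z) = t * traceInner G V := by
      rw [add_sub_cancel_left]
      exact map_smul (traceInnerLinear G) t V
    rw [h4] at h3
    have h5 := (abs_le.1 h2).1
    simp only at h0 h1 h5
    nlinarith

end

theorem mainTheorem10 (N K : ℕ) (γ : ℝ) (hγ : γ ∈ Set.Icc (0 : ℝ) 1)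
    (Zhat : Matrix (Fin N) (Fin K) ℝ) (hM : IsUnit (gramMatrix γ Zhat)) :
    IsLipschitzNear (Psi γ) Zhat ∧
      clarkeSubdifferential (Psi γ) Zhat = convexSubdifferential (modelPsi γ Zhat) Zhat := by
  have h := hasStrictFDerivAt_Psi_sub_modelPsi hγ hM
  have hm := convexOn_modelPsi hγ Zhat
  exact ⟨isLipschitzNear_of_hasStrictFDerivAt_sub hm h,
    clarkeSubdifferential_eq_of_hasStrictFDerivAt_sub hm h⟩
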